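/- Let $n,p\ge 0$ be integers, $X\in\mathbb R^{n\times p}$ a deterministic matrix and $\sigma^2,\tau^2>0$. Consider the Gaussian linear model $$Y\mid\beta\sim N(X\beta,\sigma^2 I_n),\qquad \beta\sim N(0,\tau^2 I_p),$$ and let $I(\beta;Y)=\mathbb E\big[\log\frac{p(Y\mid\beta)}{p(Y)}\big]$ be the mutual information, i.e. the Kullback–Leibler divergence of the joint law of $(\beta,Y)$ from the product of its marginals. Then $I(\beta;Y)$ is finite and $$I(\beta;Y)=\tfrac12\log\det\!\Big(I_n+\tfrac{\tau^2}{\sigma^2}XX^\top\Big)=\tfrac12\log\det\!\Big(I_p+\tfrac{\tau^2}{\sigma^2}X^\top X\Big).$$ Let $r=\mathrm{rank}(X)$ and let $s_1\ge\cdots\ge s_r>0$ be the nonzero singular values of $X$ (put $s_1=0$ if $r=0$). Then $$I(\beta;Y)=\tfrac12\sum_{j=1}^r\log\!\Big(1+\tfrac{\tau^2}{\sigma^2}s_j^2\Big).$$ Consequently, for $n\ge 3$ the Bayesian effective dimension $d_{\mathrm{eff}}(n):=2I(\beta;Y)/\log n$ satisfies $$d_{\mathrm{eff}}(n)=\frac1{\log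 n}\log\det\!\Big(I_n+\tfrac{\tau^2}{\sigma^2}XX^\top\Big)=\frac1{\log n}\sum_{j=1}^r\log\!\Big(1+\tfrac{\tau^2}{\sigma^2}s_j^2\Big)\le\frac r{\log n}\log\!\Big(1+\tfrac{\tau^2}{\sigma^2}s_1^2\Big);$$ in particular $d_{\mathrm{eff}}(n)\le 2r$ whenever $1+\tfrac{\tau^2}{\sigma^2}s_1^2\le n^2$. -/

import Mathlib

open MeasureTheory ProbabilityTheory InformationTheory
open scoped ENNReal Matrix

namespace BayesDim

/-- The mutual information `I(Θ; Z)` of two random elements: the Kullback-Leibler divergence of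
their joint law from the product of their marginal laws, i.e. the expectation, under the joint law,
of the logarithm of the density `p(θ, z) / (p(θ) p(z)) = p(z ∣ θ) / p(z)`. It is `∞` if that density
does not exist or its logarithm is not integrable. -/
noncomputable def mutualInfo {Ω T S : Type*} [MeasurableSpace Ω] [MeasurableSpace T]
    [MeasurableSpace S] (P : Measure Ω) (Θ : Ω → T) (Z : Ω → S) : ℝ≥0∞ :=
  klDiv (P.map (fun ω => (Θ ω, Z ω))) ((P.map Θ).prod (P.map Z))

/-- If the joint law has a density `p(z ∣ θ)` with respect to the product of the law of `Θ` and a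
dominating measure `ν`, then the mutual information is the expectation of `log (p(Z ∣ Θ) / p(Z))`,
where `p(z) = ∫ p(z ∣ θ) dΠ(θ)`. -/
theorem toReal_mutualInfo {Ω T S : Type*} [MeasurableSpace Ω] [MeasurableSpace T]
    [MeasurableSpace S] (P : Measure Ω) [IsProbabilityMeasure P] (Θ : Ω → T) (Z : Ω → S)
    (hΘ : AEMeasurable Θ P) (hZ : AEMeasurable Z P) (ν : Measure S) [SigmaFinite ν]
    (p : T × S → ℝ≥0∞) (hp : Measurable p)
    (h : P.map (fun ω => (Θ ω, Z ω)) = ((P.map Θ).prod ν).withDensity p) :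
    (mutualInfo P Θ Z).toReal =
      ∫ ω, Real.log ((p (Θ ω, Z ω)).toReal / (∫⁻ θ, p (θ, Z ω) ∂(P.map Θ)).toReal) ∂P := by
  have hpair : AEMeasurable (fun ω => (Θ ω, Z ω)) P := hΘ.prodMk hZ
  have i1 : IsProbabilityMeasure (P.map Θ) := Measure.isProbabilityMeasure_map hΘ
  have i2 : IsProbabilityMeasure (P.map Z) := Measure.isProbabilityMeasure_map hZ
  have i3 : IsProbabilityMeasure (P.map (fun ω => (Θ ω, Z ω))) :=
    Measure.isProbabilityMeasure_map hpair
  set q : S → ℝ≥0∞ := fun z => ∫⁻ θ, p (θ, z) ∂(P.map Θ) with hq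
  have hqm : Measurable q := hp.lintegral_prod_left'
  have hm : P.map Z = ν.withDensity q := by
    have e : P.map Z = (P.map (fun ω => (Θ ω, Z ω))).snd := (Measure.snd_map_prodMk₀ hΘ).symm
    rw [e, h]
    ext s hs
    rw [Measure.snd_apply hs, withDensity_apply _ (measurable_snd hs), withDensity_apply _ hs,
      ← lintegral_indicator (measurable_snd hs),
      lintegral_prod_symm _ ((hp.indicator (measurable_snd hs)).aemeasurable),
      ← lintegral_indicator hs]
    refine lintegral_congr fun z => ?_
    by_cases hz : z ∈ s <;> simp [hq, Set.indicator, hz]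
  have hqfin : ∀ᵐ z ∂ν, q z < ∞ := by
    refine ae_lt_top hqm ?_
    have := measure_ne_top (P.map Z) Set.univ
    rwa [hm, withDensity_apply _ MeasurableSet.univ, Measure.restrict_univ] at this
  have hprod : (P.map Θ).prod (P.map Z) =
      ((P.map Θ).prod ν).withDensity (fun x => q x.2) := by
    rw [hm]
    have : SFinite (ν.withDensity q) := by rw [← hm]; infer_instance
    exact prod_withDensity_right hqm
  have hmul : ∀ᵐ x ∂((P.map Θ).prod ν), q x.2 * (p x / q x.2) = p x := by
    have hset : MeasurableSet {x : T × S | q x.2 * (p x / q x.2) = p x} :=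
      measurableSet_eq_fun (by fun_prop) hp
    have hsw : ∀ᵐ x ∂(ν.prod (P.map Θ)),
        q x.1 * (p (x.2, x.1) / q x.1) = p (x.2, x.1) := by
      refine (Measure.ae_prod_iff_ae_ae (measurable_swap hset)).2 ?_
      filter_upwards [hqfin] with z hz
      by_cases h0 : q z = 0
      · have : (fun θ => p (θ, z)) =ᵐ[P.map Θ] 0 :=
          (lintegral_eq_zero_iff (by fun_prop)).1 h0
        filter_upwards [this] with θ hθ
        simp only [Pi.zero_apply] at hθ
        simp [hθ]
      · exact Filter.Eventually.of_forall fun θ => ENNReal.mul_div_cancel h0 hz.ne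
    have := (Measure.measurePreserving_swap (μ := P.map Θ) (ν := ν)).quasiMeasurePreserving.ae hsw
    simpa using this
  have hJ : P.map (fun ω => (Θ ω, Z ω)) =
      ((P.map Θ).prod (P.map Z)).withDensity (fun x => p x / q x.2) := by
    rw [hprod, ← withDensity_mul _ (by fun_prop) (by fun_prop), h]
    exact (withDensity_congr_ae hmul).symm
  have hac : P.map (fun ω => (Θ ω, Z ω)) ≪ (P.map Θ).prod (P.map Z) := by
    rw [hJ]; exact withDensity_absolutelyContinuous _ _
  have hrn : (P.map (fun ω => (Θ ω, Z ω))).rnDeriv ((P.map Θ).prod (P.map Z))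
      =ᵐ[P.map (fun ω => (Θ ω, Z ω))] fun x => p x / q x.2 := by
    refine hac.ae_le ?_
    have := Measure.rnDeriv_withDensity ((P.map Θ).prod (P.map Z))
      (f := fun x => p x / q x.2) (by fun_prop)
    rwa [← hJ] at this
  rw [mutualInfo, toReal_klDiv_of_measure_eq hac (by simp)]
  have : ∫ x, llr (P.map (fun ω => (Θ ω, Z ω))) ((P.map Θ).prod (P.map Z)) x
      ∂(P.map (fun ω => (Θ ω, Z ω))) =
      ∫ x, Real.log ((p x).toReal / (q x.2).toReal) ∂(P.map (fun ω => (Θ ω, Z ω))) := by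
    refine integral_congr_ae ?_
    filter_upwards [hrn] with x hx
    rw [llr, hx, ENNReal.toReal_div]
  rw [this, integral_map hpair]
  exact (Measurable.log (by fun_prop)).aestronglyMeasurable

/-- The Bayesian effective dimension `d_eff(n) = 2 I(Θ; Z) / log n` at sample size `n` (used for
`n ≥ 3`, and when the mutual information is finite). -/
noncomputable def effDim {Ω T S : Type*} [MeasurableSpace Ω] [MeasurableSpace T]
    [MeasurableSpace S] (n : ℕ) (P : Measure Ω) (Θ : Ω → T) (Z : Ω → S) : ℝ :=
  2 * (mutualInfo P Θ Z).toReal / Real.log n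

/-- The fixed-design Gaussian linear model with Gaussian prior:
`β ∼ N(0, τ² I_p)` and `Y ∣ β ∼ N(X β, σ² I_n)`. -/
structure IsGaussianLinearModel {Ω : Type*} [MeasurableSpace Ω] (P : Measure Ω)
    [IsProbabilityMeasure P] {n p : ℕ} (X : Matrix (Fin n) (Fin p) ℝ) (σ τ : ℝ)
    (β : Ω → EuclideanSpace ℝ (Fin p)) (Y : Ω → EuclideanSpace ℝ (Fin n)) : Prop where
  aemeasurable_param : AEMeasurable β P
  aemeasurable_data : AEMeasurable Y P
  prior : P.map β = multivariateGaussian 0 (τ ^ 2 • (1 : Matrix (Fin p) (Fin p) ℝ))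
  sampling : ∀ᵐ b ∂(P.map β), condDistrib Y β P b =
    multivariateGaussian (X.toEuclideanLin b) (σ ^ 2 • (1 : Matrix (Fin n) (Fin n) ℝ))

end BayesDim

namespace BayesDim

/-! In law, `Y` is `Xβ` plus independent noise `N(0, σ²I)` (`map_prodMk`), hence a centred Gaussian
with covariance `V = σ²I + τ²XXᵀ` (`map_linear_add_multivariateGaussian`). Write the noise as `A z`
and the law of `Y` as that of `B z`, with `z` standard Gaussian. The log-likelihood ratio is then
`log |det B| - log |det A| + ½‖B⁻¹Y‖² - ½‖A⁻¹(Y - Xβ)‖²`. Both vectors inside the norms are standard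
Gaussian, so the quadratic terms have the same finite mean and cancel (`klDiv_gaussianNoise`). What
remains is half the logarithm of `det V / det (σ²I)`.

Sylvester's identity replaces `XXᵀ` by `XᵀX`, whose eigenvalues are the squared singular values of
`X`, padded by zeros. The bounds on the effective dimension follow term by term. -/

/-! ### Determinants and singular values. -/

theorem singularValues_eq_zero_of_rank_le {n p : ℕ} (X : Matrix (Fin n) (Fin p) ℝ) {j : ℕ}
    (hj : X.rank ≤ j) : X.toEuclideanLin.singularValues j = 0 := by
  rw [LinearMap.singularValues_eq_zero_iff_le_finrank_range]
  rwa [X.rank_eq_finrank_range_toLin (EuclideanSpace.basisFun _ ℝ).toBasis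
    (EuclideanSpace.basisFun _ ℝ).toBasis] at hj

/-- `det (1 + c XᵀX)` as a product over the nonzero singular values of `X`. -/
theorem det_one_add_smul_transpose_mul_self {n p : ℕ} (X : Matrix (Fin n) (Fin p) ℝ) (c : ℝ) :
    (1 + c • (Xᵀ * X)).det =
      ∏ j ∈ Finset.range X.rank, (1 + c * X.toEuclideanLin.singularValues j ^ 2) := by
  set T := X.toEuclideanLin with hT
  have hn : Module.finrank ℝ (EuclideanSpace ℝ (Fin p)) = p := by simp
  have hsym := T.isSymmetric_adjoint_comp_self
  have hadj : (Xᵀ * X).toEuclideanLin = T.adjoint ∘ₗ T := by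
    rw [hT, ← Matrix.toEuclideanLin_conjTranspose_eq_adjoint,
      Matrix.conjTranspose_eq_transpose_of_trivial]
    ext v : 1
    simp
  have hlin : (1 + c • (Xᵀ * X)).toEuclideanLin = LinearMap.id + c • (T.adjoint ∘ₗ T) := by
    rw [map_add, map_smul, hadj]
    congr 1
    ext v : 1
    simp
  have h1 : (1 + c • (Xᵀ * X)).det = ∏ i : Fin p, (1 + c * T.singularValues i ^ 2) := by
    -- In an orthonormal eigenbasis of `T* T` the operator `1 + c T* T` is diagonal.
    rw [← LinearMap.det_toLpLin 2, hlin,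
      ← LinearMap.det_toMatrix (hsym.eigenvectorBasis hn).toBasis, map_add, map_smul,
      hsym.toMatrix_eigenvectorBasis, LinearMap.toMatrix_id, ← Matrix.diagonal_one,
      ← Matrix.diagonal_smul, Matrix.diagonal_add, Matrix.det_diagonal]
    refine Finset.prod_congr rfl fun i _ => ?_
    rw [T.sq_singularValues_fin hn]
    simp
  rw [h1, Fin.prod_univ_eq_prod_range (fun i => 1 + c * T.singularValues i ^ 2) p]
  symm
  -- Beyond the rank the singular values vanish and the factors are `1`.
  refine Finset.prod_subset (Finset.range_subset_range.2 (by simpa using X.rank_le_width))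
    fun j _ hj => ?_
  rw [hT, singularValues_eq_zero_of_rank_le X (by simpa using hj)]
  simp

theorem log_det_one_add_smul_transpose_mul_self {n p : ℕ} (X : Matrix (Fin n) (Fin p) ℝ) {c : ℝ}
    (hc : 0 ≤ c) :
    Real.log (1 + c • (Xᵀ * X)).det =
      ∑ j ∈ Finset.range X.rank, Real.log (1 + c * X.toEuclideanLin.singularValues j ^ 2) := by
  rw [det_one_add_smul_transpose_mul_self, Real.log_prod]
  intro j _
  positivity

theorem det_one_add_smul_mul_transpose_self {n p : ℕ} (X : Matrix (Fin n) (Fin p) ℝ) (c : ℝ) :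
    (1 + c • (X * Xᵀ)).det = (1 + c • (Xᵀ * X)).det := by
  rw [← Matrix.smul_mul, Matrix.det_one_add_mul_comm, Matrix.mul_smul]

/-! ### Densities of Gaussian measures. -/

section Density

open Complex in
/-- The standard Gaussian measure has density `(2π)^(-d/2) exp (-‖x‖² / 2)`. -/
theorem stdGaussian_eq_withDensity (E : Type*) [NormedAddCommGroup E] [InnerProductSpace ℝ E]
    [FiniteDimensional ℝ E] [MeasurableSpace E] [BorelSpace E] :
    stdGaussian E = volume.withDensity (fun x : E => ENNReal.ofReal
      (((2 * Real.pi) ^ (Module.finrank ℝ E / 2 : ℝ))⁻¹ * Real.exp (-(1 / 2) * ‖x‖ ^ 2))) := by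
  set C : ℝ := (2 * Real.pi) ^ (Module.finrank ℝ E / 2 : ℝ) with hC
  have hCpos : 0 < C := by positivity
  -- The integral of a non-integrable function is `0` by convention, while the Gaussian integral
  -- formula gives a positive value.
  have hint : Integrable (fun x : E => Real.exp (-(1 / 2) * ‖x‖ ^ 2)) := by
    by_contra h
    have := GaussianFourier.integral_rexp_neg_mul_sq_norm (V := E) (b := 1 / 2) (by norm_num)
    rw [integral_undef h] at this
    have h2 : (0 : ℝ) < (Real.pi / (1 / 2)) ^ (Module.finrank ℝ E / 2 : ℝ) := by positivity
    exact h2.ne this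
  have hfin : IsFiniteMeasure (volume.withDensity (fun x : E => ENNReal.ofReal
      (C⁻¹ * Real.exp (-(1 / 2) * ‖x‖ ^ 2)))) :=
    isFiniteMeasure_withDensity_ofReal (hint.const_mul _).2
  refine Measure.ext_of_charFun (funext fun t => ?_)
  rw [charFun_stdGaussian, charFun_apply,
    integral_withDensity_eq_integral_toReal_smul (by fun_prop) (by simp)]
  -- With linear coefficient `I`, this integral is the unnormalised characteristic function at `t`.
  have hF := GaussianFourier.integral_cexp_neg_mul_sq_norm_add (V := E) (b := 1 / 2)
    (by norm_num) I t
  have hCC : ((Real.pi : ℂ) / (1 / 2)) ^ (Module.finrank ℝ E / 2 : ℂ) = (C : ℂ) := by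
    rw [hC, Complex.ofReal_cpow (by positivity)]
    push_cast
    congr 1
    ring
  rw [hCC] at hF
  calc cexp (-‖t‖ ^ 2 / 2) = (C : ℂ)⁻¹ * (C * cexp (I ^ 2 * ‖t‖ ^ 2 / (4 * (1 / 2)))) := by
        rw [inv_mul_cancel_left₀ (by exact_mod_cast hCpos.ne')]
        congr 1
        rw [I_sq]
        ring
    _ = _ := by
        rw [← hF, ← integral_const_mul]
        refine integral_congr_ae (.of_forall fun x => ?_)
        simp only
        rw [ENNReal.toReal_ofReal (by positivity), Complex.exp_add, real_smul, real_inner_comm]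
        push_cast
        rw [mul_comm I]
        ring

/-- The density at `v` of the image of the standard Gaussian measure under `B`. -/
noncomputable def gaussianDensity {E : Type*} [NormedAddCommGroup E] [InnerProductSpace ℝ E]
    (B : E ≃L[ℝ] E) (v : E) : ℝ :=
  ((2 * Real.pi) ^ (Module.finrank ℝ E / 2 : ℝ))⁻¹ * |LinearMap.det (B : E →ₗ[ℝ] E)|⁻¹ *
    Real.exp (-(1 / 2) * ‖B.symm v‖ ^ 2)

variable {E : Type*} [NormedAddCommGroup E] [InnerProductSpace ℝ E]

theorem det_ne_zero (B : E ≃L[ℝ] E) : LinearMap.det (B : E →ₗ[ℝ] E) ≠ 0 :=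
  (LinearEquiv.isUnit_det' B.toLinearEquiv).ne_zero

theorem gaussianDensity_pos (B : E ≃L[ℝ] E) (v : E) : 0 < gaussianDensity B v := by
  have := abs_pos.2 (det_ne_zero B)
  unfold gaussianDensity
  positivity

theorem log_gaussianDensity (B : E ≃L[ℝ] E) (v : E) :
    Real.log (gaussianDensity B v) = -Real.log ((2 * Real.pi) ^ (Module.finrank ℝ E / 2 : ℝ)) -
      Real.log |LinearMap.det (B : E →ₗ[ℝ] E)| - 1 / 2 * ‖B.symm v‖ ^ 2 := by
  have := abs_pos.2 (det_ne_zero B)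
  rw [gaussianDensity, Real.log_mul (by positivity) (by positivity),
    Real.log_mul (by positivity) (by positivity), Real.log_exp, Real.log_inv, Real.log_inv]
  ring

@[fun_prop]
theorem measurable_gaussianDensity [MeasurableSpace E] [BorelSpace E] (B : E ≃L[ℝ] E) :
    Measurable (gaussianDensity B) := by
  have : Continuous (gaussianDensity B) := by
    unfold gaussianDensity
    fun_prop
  exact this.measurable

variable [FiniteDimensional ℝ E] [MeasurableSpace E] [BorelSpace E]

theorem map_stdGaussian_eq_withDensity (B : E ≃L[ℝ] E) (m : E) :
    (stdGaussian E).map (fun x => m + B x) =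
      volume.withDensity (fun y => ENNReal.ofReal (gaussianDensity B (y - m))) := by
  have hd := abs_pos.2 (det_ne_zero B)
  have hvol : (volume : Measure E).map (fun x => m + B x) =
      ENNReal.ofReal |(LinearMap.det (B : E →ₗ[ℝ] E))⁻¹| • volume := by
    have h := Measure.map_linearMap_addHaar_eq_smul_addHaar (volume : Measure E) (det_ne_zero B)
    have hB : ⇑(B : E →ₗ[ℝ] E) = B := rfl
    rw [hB] at h
    rw [show (fun x => m + B x) = (fun y => m + y) ∘ B from rfl,
      ← Measure.map_map (by fun_prop) (by fun_prop), h, Measure.map_smul, map_add_left_eq_self]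
  refine Measure.ext_of_lintegral _ fun φ hφ => ?_
  rw [lintegral_map hφ (by fun_prop), stdGaussian_eq_withDensity,
    lintegral_withDensity_eq_lintegral_mul _ (by fun_prop) (by fun_prop),
    lintegral_withDensity_eq_lintegral_mul _ (by fun_prop) hφ]
  -- Change of variables: volume is `|det B|` times its own image, which turns both sides into
  -- integrals over `x`.
  have hv2 : (volume : Measure E) = ENNReal.ofReal |LinearMap.det (B : E →ₗ[ℝ] E)| •
      (volume : Measure E).map (fun x => m + B x) := by
    rw [hvol, smul_smul, ← ENNReal.ofReal_mul hd.le, abs_inv, mul_inv_cancel₀ hd.ne']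
    simp
  conv_rhs => rw [hv2]
  rw [lintegral_smul_measure, lintegral_map (by fun_prop) (by fun_prop), smul_eq_mul,
    ← lintegral_const_mul _ (by fun_prop)]
  refine lintegral_congr fun x => ?_
  simp only [Pi.mul_apply, add_sub_cancel_left]
  rw [← mul_assoc, ← ENNReal.ofReal_mul hd.le]
  congr 2
  simp only [gaussianDensity, ContinuousLinearEquiv.symm_apply_apply]
  field_simp

end Density

/-! ### Divergence between signal-plus-noise and independence. -/

section KullbackLeibler

/-- If `J` and `m` have positive densities `p` and `q` with respect to `π × ν` and `ν`, then the
log-likelihood ratio of `J` and `π × m` is `log p - log q`. -/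
theorem llr_withDensity_prod {T S : Type*} [MeasurableSpace T] [MeasurableSpace S]
    {π : Measure T} [IsProbabilityMeasure π] {ν m : Measure S} [SigmaFinite ν]
    [IsProbabilityMeasure m] {J : Measure (T × S)} {p : T × S → ℝ} {q : S → ℝ}
    (hp : Measurable p) (hq : Measurable q) (hp0 : ∀ x, 0 < p x) (hq0 : ∀ y, 0 < q y)
    (hJ : J = (π.prod ν).withDensity (fun x => ENNReal.ofReal (p x)))
    (hm : m = ν.withDensity (fun y => ENNReal.ofReal (q y))) :
    J ≪ π.prod m ∧ llr J (π.prod m) =ᵐ[J] fun x => Real.log (p x) - Real.log (q x.2) := by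
  have hprod : π.prod m = (π.prod ν).withDensity (fun x => ENNReal.ofReal (q x.2)) := by
    have : SFinite (ν.withDensity fun y => ENNReal.ofReal (q y)) := by rw [← hm]; infer_instance
    rw [hm]
    exact prod_withDensity_right (by fun_prop)
  -- Positivity of `q` allows division, so `p / q` is the density relative to `π × m`.
  have hJ' : J = (π.prod m).withDensity (fun x => ENNReal.ofReal (p x / q x.2)) := by
    rw [hprod, ← withDensity_mul _ (by fun_prop) (by fun_prop), hJ]
    congr 1
    ext x
    rw [Pi.mul_apply, ← ENNReal.ofReal_mul (hq0 _).le, mul_div_cancel₀ _ (hq0 _).ne']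
  have hac : J ≪ π.prod m := by
    rw [hJ']
    exact withDensity_absolutelyContinuous _ _
  refine ⟨hac, ?_⟩
  have hrn := Measure.rnDeriv_withDensity (π.prod m)
    (f := fun x => ENNReal.ofReal (p x / q x.2)) (by fun_prop)
  rw [← hJ'] at hrn
  filter_upwards [hac.ae_le hrn] with x hx
  rw [llr, hx, ENNReal.toReal_ofReal (div_pos (hp0 x) (hq0 _)).le,
    Real.log_div (hp0 x).ne' (hq0 _).ne']

variable {E : Type*} [NormedAddCommGroup E] [InnerProductSpace ℝ E] [FiniteDimensional ℝ E]
  [MeasurableSpace E] [BorelSpace E]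

theorem integrable_norm_sq_stdGaussian :
    Integrable (fun z : E => ‖z‖ ^ 2) (stdGaussian E) :=
  (IsGaussian.memLp_two_id (μ := stdGaussian E)).integrable_norm_pow (by norm_num)

variable {T : Type*} [MeasurableSpace T] {π : Measure T} {f : T → E}

/-- By Tonelli it suffices to fix the signal; each fibre is then an affine image of the standard
Gaussian. -/
theorem map_gaussianNoise_eq_withDensity [SFinite π] (hf : Measurable f) (A : E ≃L[ℝ] E) :
    (π.prod (stdGaussian E)).map (fun x => (x.1, f x.1 + A x.2)) =
      (π.prod volume).withDensity
        (fun x => ENNReal.ofReal (gaussianDensity A (x.2 - f x.1))) := by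
  refine Measure.ext_of_lintegral _ fun φ hφ => ?_
  rw [lintegral_map hφ (by fun_prop), lintegral_prod _ (by fun_prop),
    lintegral_withDensity_eq_lintegral_mul _ (by fun_prop) hφ, lintegral_prod _ (by fun_prop)]
  refine lintegral_congr fun b => ?_
  have h := map_stdGaussian_eq_withDensity A (f b)
  calc ∫⁻ z, φ (b, f b + A z) ∂stdGaussian E
      = ∫⁻ y, φ (b, y) ∂(stdGaussian E).map (fun z => f b + A z) := by
        rw [lintegral_map (by fun_prop) (by fun_prop)]
    _ = _ := by
        rw [h, lintegral_withDensity_eq_lintegral_mul _ (by fun_prop) (by fun_prop)]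
        rfl

/-- The divergence from independence of a signal `θ` and its observation `f θ + A z` in Gaussian
noise, when the observation is itself Gaussian. -/
theorem klDiv_gaussianNoise [IsProbabilityMeasure π] (hf : Measurable f) (A B : E ≃L[ℝ] E) {J : Measure (T × E)}
    {m : Measure E}
    (hJ : J = (π.prod (stdGaussian E)).map (fun x => (x.1, f x.1 + A x.2)))
    (hsnd : J.map Prod.snd = m) (hm : m = (stdGaussian E).map (fun z => 0 + B z)) :
    klDiv J (π.prod m) ≠ ∞ ∧
      (klDiv J (π.prod m)).toReal =
        Real.log |LinearMap.det (B : E →ₗ[ℝ] E)| - Real.log |LinearMap.det (A : E →ₗ[ℝ] E)| := by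
  have hmap : Measurable fun x : T × E => (x.1, f x.1 + A x.2) := by fun_prop
  have : IsProbabilityMeasure J := by
    rw [hJ]
    exact Measure.isProbabilityMeasure_map hmap.aemeasurable
  have : IsProbabilityMeasure m := by
    rw [hm]
    exact Measure.isProbabilityMeasure_map (by fun_prop)
  obtain ⟨hac, hllr⟩ := llr_withDensity_prod (π := π) (m := m) (J := J)
    (p := fun x => gaussianDensity A (x.2 - f x.1)) (q := fun y => gaussianDensity B (y - 0))
    (by fun_prop) (by fun_prop) (fun _ => gaussianDensity_pos _ _)
    (fun _ => gaussianDensity_pos _ _)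
    (hJ.trans (map_gaussianNoise_eq_withDensity hf A))
    (hm.trans (map_stdGaussian_eq_withDensity B 0))
  have hA : Integrable (fun x : T × E => ‖A.symm (x.2 - f x.1)‖ ^ 2) J ∧
      ∫ x, ‖A.symm (x.2 - f x.1)‖ ^ 2 ∂J = ∫ z, ‖z‖ ^ 2 ∂stdGaussian E := by
    have hmeas : Measurable fun x : T × E => ‖A.symm (x.2 - f x.1)‖ ^ 2 := by fun_prop
    rw [hJ, integrable_map_measure hmeas.aestronglyMeasurable hmap.aemeasurable,
      integral_map hmap.aemeasurable hmeas.aestronglyMeasurable]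
    simp only [Function.comp_def, add_sub_cancel_left, ContinuousLinearEquiv.symm_apply_apply]
    refine ⟨integrable_norm_sq_stdGaussian.comp_snd π, ?_⟩
    rw [integral_fun_snd (fun z : E => ‖z‖ ^ 2)]
    simp
  -- Only the second marginal of `J` matters here, and `B⁻¹` carries it back to the standard
  -- Gaussian.
  have hB : Integrable (fun x : T × E => ‖B.symm (x.2 - 0)‖ ^ 2) J ∧
      ∫ x, ‖B.symm (x.2 - 0)‖ ^ 2 ∂J = ∫ z, ‖z‖ ^ 2 ∂stdGaussian E := by
    have hmeas : Measurable fun y : E => ‖B.symm (y - 0)‖ ^ 2 := by fun_prop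
    have e : J.map Prod.snd = (stdGaussian E).map (fun z => 0 + B z) := hsnd.trans hm
    have hi := integrable_map_measure (μ := J) (f := Prod.snd) hmeas.aestronglyMeasurable
      measurable_snd.aemeasurable
    have hi' := integral_map (μ := J) (φ := Prod.snd) measurable_snd.aemeasurable
      hmeas.aestronglyMeasurable
    rw [e, integrable_map_measure hmeas.aestronglyMeasurable (by fun_prop)] at hi
    rw [e, integral_map (by fun_prop) hmeas.aestronglyMeasurable] at hi'
    simp only [Function.comp_def, ContinuousLinearEquiv.symm_apply_apply, sub_zero,
      zero_add] at hi hi' ⊢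
    exact ⟨hi.1 integrable_norm_sq_stdGaussian, hi'.symm⟩
  have hllr' : llr J (π.prod m) =ᵐ[J] fun x =>
      (Real.log |LinearMap.det (B : E →ₗ[ℝ] E)| - Real.log |LinearMap.det (A : E →ₗ[ℝ] E)|) +
        (1 / 2 * ‖B.symm (x.2 - 0)‖ ^ 2 - 1 / 2 * ‖A.symm (x.2 - f x.1)‖ ^ 2) := by
    filter_upwards [hllr] with x hx
    rw [hx, log_gaussianDensity, log_gaussianDensity]
    ring
  have hi1 : Integrable (fun x : T × E =>
      1 / 2 * ‖B.symm (x.2 - 0)‖ ^ 2 - 1 / 2 * ‖A.symm (x.2 - f x.1)‖ ^ 2) J := (hB.1.const_mul (1 / 2)).sub (hA.1.const_mul (1 / 2))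
  refine ⟨klDiv_ne_top hac (((integrable_const _).add hi1).congr hllr'.symm), ?_⟩
  rw [toReal_klDiv_of_measure_eq hac (by simp), integral_congr_ae hllr',
    integral_add (integrable_const _) hi1,
    integral_sub (hB.1.const_mul (1 / 2)) (hA.1.const_mul (1 / 2)), integral_const_mul,
    integral_const_mul, hA.2, hB.2]
  simp

end KullbackLeibler

/-! ### Multivariate Gaussians and the linear model. -/

open scoped MatrixOrder in
/-- A nondegenerate Gaussian measure is an affine image of the standard one. -/
theorem exists_multivariateGaussian_eq_map {ι : Type*} [Fintype ι] [DecidableEq ι]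
    {S : Matrix ι ι ℝ} (hS : S.PosDef) :
    ∃ B : EuclideanSpace ℝ ι ≃L[ℝ] EuclideanSpace ℝ ι,
      (∀ m, multivariateGaussian m S = (stdGaussian (EuclideanSpace ℝ ι)).map (fun x => m + B x)) ∧
      Real.log |LinearMap.det (B : EuclideanSpace ℝ ι →ₗ[ℝ] EuclideanSpace ℝ ι)| =
        1 / 2 * Real.log S.det := by
  set R := CFC.sqrt S with hR
  have hsq : R.det * R.det = S.det := by
    rw [← Matrix.det_mul, hR, CFC.sqrt_mul_sqrt_self _ hS.posSemidef.nonneg]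
  have hR0 : R.det ≠ 0 := by
    intro h
    have := hS.det_pos
    rw [← hsq, h] at this
    simp at this
  have hdet : LinearMap.det R.toEuclideanLin = R.det := LinearMap.det_toLpLin 2 R
  refine ⟨(LinearEquiv.ofIsUnitDet (f := R.toEuclideanLin)
    (v := (EuclideanSpace.basisFun ι ℝ).toBasis) (v' := (EuclideanSpace.basisFun ι ℝ).toBasis)
    (by rw [LinearMap.det_toMatrix, hdet]; exact hR0.isUnit)).toContinuousLinearEquiv,
    fun m => rfl, ?_⟩
  have : LinearMap.det (((LinearEquiv.ofIsUnitDet (f := R.toEuclideanLin)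
    (v := (EuclideanSpace.basisFun ι ℝ).toBasis) (v' := (EuclideanSpace.basisFun ι ℝ).toBasis)
    (by rw [LinearMap.det_toMatrix, hdet]; exact hR0.isUnit)).toContinuousLinearEquiv :
      EuclideanSpace ℝ ι ≃L[ℝ] EuclideanSpace ℝ ι) : EuclideanSpace ℝ ι →ₗ[ℝ] EuclideanSpace ℝ ι) =
      R.det := hdet
  rw [this, ← hsq, Real.log_mul hR0 hR0, Real.log_abs]
  ring

open Complex in
/-- A linear image of a centred Gaussian vector plus independent centred Gaussian noise. -/
theorem map_linear_add_multivariateGaussian {n p : ℕ} (X : Matrix (Fin n) (Fin p) ℝ)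
    {S : Matrix (Fin p) (Fin p) ℝ} {R : Matrix (Fin n) (Fin n) ℝ} (hS : S.PosSemidef)
    (hR : R.PosSemidef) :
    ((multivariateGaussian 0 S).prod (multivariateGaussian 0 R)).map
      (fun x => X.toEuclideanLin x.1 + x.2) = multivariateGaussian 0 (R + X * S * Xᵀ) := by
  have hXS : (X * S * Xᵀ).PosSemidef := by
    have := hS.mul_mul_conjTranspose_same X
    rwa [Matrix.conjTranspose_eq_transpose_of_trivial] at this
  have hXm : Measurable X.toEuclideanLin :=
    (LinearMap.continuous_of_finiteDimensional _).measurable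
  refine Measure.ext_of_charFun (funext fun t => ?_)
  have h1 : ((multivariateGaussian 0 S).prod (multivariateGaussian 0 R)).map
      (fun x => X.toEuclideanLin x.1 + x.2) =
      (((multivariateGaussian 0 S).map X.toEuclideanLin).prod (multivariateGaussian 0 R)).map
        (fun x => x.1 + x.2) := by
    have : IsProbabilityMeasure ((multivariateGaussian 0 S).map X.toEuclideanLin) :=
      Measure.isProbabilityMeasure_map hXm.aemeasurable
    conv_rhs => rw [← Measure.map_id (μ := multivariateGaussian 0 R)]
    rw [Measure.map_prod_map _ _ hXm measurable_id, Measure.map_map (by fun_prop) (by fun_prop)]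
    rfl
  have : IsProbabilityMeasure ((multivariateGaussian 0 S).map X.toEuclideanLin) :=
    Measure.isProbabilityMeasure_map hXm.aemeasurable
  have h2 : charFun ((multivariateGaussian 0 S).map X.toEuclideanLin) t =
      charFun (multivariateGaussian 0 S) (Xᵀ.toEuclideanLin t) := by
    rw [charFun_apply, charFun_apply, integral_map hXm.aemeasurable (by fun_prop)]
    congr with x
    rw [← Matrix.conjTranspose_eq_transpose_of_trivial,
      Matrix.toEuclideanLin_conjTranspose_eq_adjoint, LinearMap.adjoint_inner_right]
  rw [h1, charFun_map_add_prod_eq_mul, Pi.mul_apply, h2, charFun_multivariateGaussian hS,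
    charFun_multivariateGaussian hR, charFun_multivariateGaussian (hR.add hXS), ← Complex.exp_add]
  congr 1
  have h3 : (Xᵀ.toEuclideanLin t).ofLp ⬝ᵥ S *ᵥ (Xᵀ.toEuclideanLin t).ofLp =
      t.ofLp ⬝ᵥ (X * S * Xᵀ) *ᵥ t.ofLp := by
    simp only [Matrix.toLpLin_apply]
    rw [← Matrix.mulVec_mulVec, ← Matrix.mulVec_mulVec, Matrix.dotProduct_mulVec t.ofLp X,
      Matrix.mulVec_transpose]
  rw [h3, Matrix.add_mulVec, dotProduct_add]
  simp
  ring

/-- Disintegrate along `β`: each conditional law is the noise law translated by `X b`. Independent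
noise appears only in law, not as a variable on `Ω`. -/
theorem IsGaussianLinearModel.map_prodMk {Ω : Type*} [MeasurableSpace Ω] {P : Measure Ω}
    [IsProbabilityMeasure P] {n p : ℕ} {X : Matrix (Fin n) (Fin p) ℝ} {σ τ : ℝ}
    {β : Ω → EuclideanSpace ℝ (Fin p)} {Y : Ω → EuclideanSpace ℝ (Fin n)}
    (h : IsGaussianLinearModel P X σ τ β Y) :
    P.map (fun ω => (β ω, Y ω)) =
      ((P.map β).prod (multivariateGaussian 0 (σ ^ 2 • (1 : Matrix (Fin n) (Fin n) ℝ)))).map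
        (fun x => (x.1, X.toEuclideanLin x.1 + x.2)) := by
  have hXm : Measurable X.toEuclideanLin :=
    (LinearMap.continuous_of_finiteDimensional _).measurable
  have : IsProbabilityMeasure (P.map β) := Measure.isProbabilityMeasure_map h.aemeasurable_param
  rw [← compProd_map_condDistrib h.aemeasurable_data]
  ext s hs
  rw [Measure.compProd_apply hs, Measure.map_apply (by fun_prop) hs,
    Measure.prod_apply (hs.preimage (by fun_prop))]
  refine lintegral_congr_ae ?_
  filter_upwards [h.sampling] with b hb
  have hshift : multivariateGaussian (X.toEuclideanLin b)
      (σ ^ 2 • (1 : Matrix (Fin n) (Fin n) ℝ)) = (multivariateGaussian 0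
        (σ ^ 2 • (1 : Matrix (Fin n) (Fin n) ℝ))).map (fun y => X.toEuclideanLin b + y) := by
    rw [multivariateGaussian, multivariateGaussian, Measure.map_map (by fun_prop) (by fun_prop)]
    simp [Function.comp_def]
  rw [hb, hshift, Measure.map_apply (by fun_prop) (hs.preimage (by fun_prop))]
  rfl

/-- The mutual information of the parameter and the data in the Gaussian linear model. -/
theorem IsGaussianLinearModel.mutualInfo_eq {Ω : Type*} [MeasurableSpace Ω] {P : Measure Ω}
    [IsProbabilityMeasure P] {n p : ℕ} {X : Matrix (Fin n) (Fin p) ℝ} {σ τ : ℝ} (hσ : 0 < σ)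
    {β : Ω → EuclideanSpace ℝ (Fin p)} {Y : Ω → EuclideanSpace ℝ (Fin n)}
    (h : IsGaussianLinearModel P X σ τ β Y) :
    mutualInfo P β Y ≠ ∞ ∧ (mutualInfo P β Y).toReal =
      1 / 2 * Real.log (1 + (τ ^ 2 / σ ^ 2) • (X * Xᵀ)).det := by
  have hXm : Measurable X.toEuclideanLin :=
    (LinearMap.continuous_of_finiteDimensional _).measurable
  have : IsProbabilityMeasure (P.map β) := Measure.isProbabilityMeasure_map h.aemeasurable_param
  have hR : (σ ^ 2 • (1 : Matrix (Fin n) (Fin n) ℝ)).PosDef :=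
    Matrix.PosDef.one.smul (by positivity)
  have hS : (τ ^ 2 • (1 : Matrix (Fin p) (Fin p) ℝ)).PosSemidef :=
    Matrix.PosSemidef.one.smul (by positivity)
  have hXS : (X * (τ ^ 2 • (1 : Matrix (Fin p) (Fin p) ℝ)) * Xᵀ).PosSemidef := by
    have := hS.mul_mul_conjTranspose_same X
    rwa [Matrix.conjTranspose_eq_transpose_of_trivial] at this
  have hV := hR.add_posSemidef hXS
  obtain ⟨A, hA, hAdet⟩ := exists_multivariateGaussian_eq_map hR
  obtain ⟨B, hB, hBdet⟩ := exists_multivariateGaussian_eq_map hV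
  have hJ := h.map_prodMk
  have hsnd : (P.map (fun ω => (β ω, Y ω))).map Prod.snd = P.map Y :=
    Measure.snd_map_prodMk₀ h.aemeasurable_param
  have hY : P.map Y = multivariateGaussian 0 (σ ^ 2 • (1 : Matrix (Fin n) (Fin n) ℝ) +
      X * (τ ^ 2 • (1 : Matrix (Fin p) (Fin p) ℝ)) * Xᵀ) := by
    rw [← hsnd, hJ, Measure.map_map (by fun_prop) (by fun_prop), h.prior]
    exact map_linear_add_multivariateGaussian X hS hR.posSemidef
  have hJ' : P.map (fun ω => (β ω, Y ω)) = ((P.map β).prod (stdGaussian _)).map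
      (fun x => (x.1, X.toEuclideanLin x.1 + A x.2)) := by
    rw [hJ, hA]
    conv_lhs => rw [← Measure.map_id (μ := P.map β)]
    rw [Measure.map_prod_map _ _ measurable_id (by fun_prop),
      Measure.map_map (by fun_prop) (by fun_prop)]
    simp [Function.comp_def, Prod.map]
  obtain ⟨h1, h2⟩ := klDiv_gaussianNoise hXm A B hJ' hsnd (hY.trans (hB 0))
  refine ⟨h1, h2.trans ?_⟩
  have hdet : (σ ^ 2 • (1 : Matrix (Fin n) (Fin n) ℝ) +
      X * (τ ^ 2 • (1 : Matrix (Fin p) (Fin p) ℝ)) * Xᵀ).det =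
      (σ ^ 2 • (1 : Matrix (Fin n) (Fin n) ℝ)).det * (1 + (τ ^ 2 / σ ^ 2) • (X * Xᵀ)).det := by
    rw [← Matrix.det_mul]
    congr 1
    simp only [Matrix.mul_smul, Matrix.smul_mul, Matrix.one_mul, Matrix.mul_one, smul_add,
      smul_smul]
    congr 2
    field_simp
  -- Needed to split the logarithm of the product; inherited from `det V > 0`.
  have hne : (1 + (τ ^ 2 / σ ^ 2) • (X * Xᵀ)).det ≠ 0 := by
    intro h0
    have := hV.det_pos
    rw [hdet, h0, mul_zero] at this
    exact this.false
  rw [hAdet, hBdet, hdet, Real.log_mul hR.det_pos.ne' hne]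
  ring

end BayesDim

/-! ### The main theorem. -/

theorem proposition3p2 {Ω : Type*} [MeasurableSpace Ω] (P : Measure Ω) [IsProbabilityMeasure P]
    (n p : ℕ) (X : Matrix (Fin n) (Fin p) ℝ) (σ τ : ℝ) (hσ : 0 < σ) (hτ : 0 < τ)
    (β : Ω → EuclideanSpace ℝ (Fin p)) (Y : Ω → EuclideanSpace ℝ (Fin n))
    (hmodel : BayesDim.IsGaussianLinearModel P X σ τ β Y) :
    BayesDim.mutualInfo P β Y ≠ ∞ ∧
    (BayesDim.mutualInfo P β Y).toReal =
      1 / 2 * Real.log (1 + (τ ^ 2 / σ ^ 2) • (X * Xᵀ)).det ∧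
    (BayesDim.mutualInfo P β Y).toReal =
      1 / 2 * Real.log (1 + (τ ^ 2 / σ ^ 2) • (Xᵀ * X)).det ∧
    (BayesDim.mutualInfo P β Y).toReal =
      1 / 2 * ∑ j ∈ Finset.range X.rank,
        Real.log (1 + τ ^ 2 / σ ^ 2 * X.toEuclideanLin.singularValues j ^ 2) ∧
    (3 ≤ n →
      BayesDim.effDim n P β Y =
        1 / Real.log n * Real.log (1 + (τ ^ 2 / σ ^ 2) • (X * Xᵀ)).det ∧
      BayesDim.effDim n P β Y =
        1 / Real.log n * ∑ j ∈ Finset.range X.rank,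
          Real.log (1 + τ ^ 2 / σ ^ 2 * X.toEuclideanLin.singularValues j ^ 2) ∧
      BayesDim.effDim n P β Y ≤
        X.rank / Real.log n *
          Real.log (1 + τ ^ 2 / σ ^ 2 * X.toEuclideanLin.singularValues 0 ^ 2) ∧
      (1 + τ ^ 2 / σ ^ 2 * X.toEuclideanLin.singularValues 0 ^ 2 ≤ (n : ℝ) ^ 2 →
        BayesDim.effDim n P β Y ≤ 2 * X.rank)) := by
  obtain ⟨hfin, hI⟩ := hmodel.mutualInfo_eq hσ
  have hc : 0 ≤ τ ^ 2 / σ ^ 2 := by positivity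
  have hdet := BayesDim.det_one_add_smul_mul_transpose_self X (τ ^ 2 / σ ^ 2)
  have hlog := BayesDim.log_det_one_add_smul_transpose_mul_self X hc
  refine ⟨hfin, hI, by rw [hI, hdet], by rw [hI, hdet, hlog], fun hn => ?_⟩
  have hn' : (1 : ℝ) < n := by exact_mod_cast (by omega : 1 < n)
  have hlogn : 0 < Real.log n := Real.log_pos hn'
  have heff : BayesDim.effDim n P β Y =
      1 / Real.log n * Real.log (1 + (τ ^ 2 / σ ^ 2) • (X * Xᵀ)).det := by
    rw [BayesDim.effDim, hI]
    ring
  have hle : BayesDim.effDim n P β Y ≤ X.rank / Real.log n *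
      Real.log (1 + τ ^ 2 / σ ^ 2 * X.toEuclideanLin.singularValues 0 ^ 2) := by
    rw [heff, hdet, hlog, one_div_mul_eq_div, div_mul_eq_mul_div]
    gcongr
    -- Indexing starts at `0`, so the largest singular value has index `0`; it dominates each of the
    -- `rank X` terms.
    refine (Finset.sum_le_card_nsmul _ _ _ fun j _ => ?_).trans_eq
      (by rw [Finset.card_range, nsmul_eq_mul])
    have h0 := X.toEuclideanLin.singularValues_nonneg j
    have h1 := X.toEuclideanLin.singularValues_antitone (Nat.zero_le j)
    gcongr
  refine ⟨heff, by rw [heff, hdet, hlog], hle, fun hbound => hle.trans ?_⟩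
  have h2 : Real.log (1 + τ ^ 2 / σ ^ 2 * X.toEuclideanLin.singularValues 0 ^ 2) ≤
      2 * Real.log n := by
    refine (Real.log_le_log (by positivity) hbound).trans_eq ?_
    rw [Real.log_pow]
    norm_num
  calc _ ≤ X.rank / Real.log n * (2 * Real.log n) := by gcongr
    _ = 2 * X.rank := by field_simp
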